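/- All graphs are finite and simple. For a graph $G=(V,E)$, let $\omega(G)$ be its clique number (the largest number of pairwise adjacent vertices), let $N_G(v)$ be the set of neighbours of a vertex $v$, and let $G\setminus v$ be the graph obtained from $G$ by deleting $v$. The square $G^2$ of $G$ has the same vertex set as $G$, and two distinct vertices are adjacent in $G^2$ if and only if they are adjacent in $G$ or have a common neighbour in $G$; $\deg_{G^2}(v)$ is the degree of $v$ in $G^2$. The graph $G$ is claw-free if it has no induced subgraph isomorphic to $K_{1,3}$. The line graph $L(F)$ of a graph $F$ has the edges of $F$ as its vertices, two distinct edges of $F$ being adjacent in $L(F)$ if and only if they share an endpoint. Theorem. Let $G=(V,E)$ be a connected claw-free graph with $\omega(G)=4$. Then at least one of the following is true: 1. $G$ is (isomorphic to) the line graph $L(F)$ of a graph $F$ of maximum degree $4$; or 2. there exists $v\in V$ with $\deg_{G^2}(v)\le 19$ such that the set of all vertices $x\in N_G(v)$ with $\deg_{G^2}(x)\ge 21$ induces a clique in $(G\setminus v)^2$; that is, any two distinct vertices of this (possibly empty) set are adjacent in $(G\setminus v)^2$. -/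

import Mathlib

/-- `G` is claw-free: it has no induced subgraph isomorphic to `K_{1,3}`. -/
def ClawFree {V : Type*} (G : SimpleGraph V) : Prop :=
  ¬ SimpleGraph.IsIndContained (completeBipartiteGraph (Fin 1) (Fin 3)) G

/-- The square `G²`: edges are added between those pairs of distinct vertices that are connected
by a two-edge path in `G`. -/
def graphSquare {V : Type*} (G : SimpleGraph V) : SimpleGraph V where
  Adj u w := u ≠ w ∧ (G.Adj u w ∨ ∃ z, G.Adj u z ∧ G.Adj z w)
  symm := by
    constructor
    rintro u w ⟨hne, h | ⟨z, h₁, h₂⟩⟩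
    · exact ⟨hne.symm, Or.inl h.symm⟩
    · exact ⟨hne.symm, Or.inr ⟨z, h₂.symm, h₁.symm⟩⟩
  loopless := ⟨fun _ h => h.1 rfl⟩

/-- `G \ v`: the graph obtained from `G` by deleting the vertex `v`. -/
def deleteVertex {V : Type*} (G : SimpleGraph V) (v : V) : SimpleGraph {u : V // u ≠ v} :=
  G.induce {u : V | u ≠ v}

/-! Suppose the second alternative fails. The aim is to split every neighbourhood `N(v)` into two
cliques `A`, `B` such that `{v} ∪ A` and `{v} ∪ B` do not depend on the member from which they are
seen. These closed cliques then form a Krausz partition, so `G` is a line graph; clique number 4 and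
one part of size 3 give maximum degree 4.

If `v` has square degree at least 20, the splitting comes from counting. By claw-freeness the
neighbours of `x ∈ N(v)` outside `N[v]` form a clique, so there are at most 3. Each vertex at
distance two sees a simplicial vertex of `N(v)` or two vertices of `N(v)`, whence `2 deg_{G²}(v) + 3
s ≤ 8 deg(v)`, with `s` the number of non-simplicial neighbours (`two_mul_degree_graphSquare_le`).
Degree at least 7 forces square degree at most 17, so `deg(v)` is 5 or 6, `s ≤ 2`, and at most one
edge joins `A` to `B`.

If `v` has square degree at most 19, failure of the second alternative gives neighbours `x`, `y` of
square degree at least 21, nonadjacent and with `v` as only common neighbour. Square degree 21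
forces six neighbours and a neighbourhood without induced path on three vertices, so `x` and `y`
each determine one part of `N(v)` (`exists_nbhdSplit_of_pair`). There may be several edges between
the parts, but the path-free neighbourhoods of `x` and `y` compensate; `NbhdSplit` records this
dichotomy, and `NbhdSplit.same_part` shows that either case yields consistency. -/

section LineGraphs
open Classical

/-! ### Line graphs from clique partitions -/

/-- Krausz's criterion: a graph whose edges are partitioned into cliques `C i` such that every
vertex `v` lies in exactly two of them, `C (p v)` and `C (q v)`, is the line graph of the
intersection graph of these cliques. -/
theorem exists_iso_lineGraph_of_cliques {V ι : Type*} [Fintype V] [Fintype ι] (G : SimpleGraph V)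
    (C : ι → Finset V) (p q : V → ι) (hpq : ∀ v, p v ≠ q v)
    (hmem : ∀ v i, v ∈ C i ↔ i = p v ∨ i = q v)
    (hadj : ∀ u v, u ≠ v → (G.Adj u v ↔ ∃ i, u ∈ C i ∧ v ∈ C i))
    (hinter : ∀ i j u v, i ≠ j → u ∈ C i → u ∈ C j → v ∈ C i → v ∈ C j → u = v) :
    ∃ F : SimpleGraph ι, (∀ i, F.degree i = (C i).card) ∧ Nonempty (G ≃g F.lineGraph) := by
  let F : SimpleGraph ι :=
    { Adj := fun i j => i ≠ j ∧ ∃ v, v ∈ C i ∧ v ∈ C j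
      symm := ⟨fun i j h => ⟨h.1.symm, h.2.imp fun v hv => hv.symm⟩⟩
      loopless := ⟨fun i h => h.1 rfl⟩ }
  have hp : ∀ v, v ∈ C (p v) := fun v => (hmem v _).2 (Or.inl rfl)
  have hq : ∀ v, v ∈ C (q v) := fun v => (hmem v _).2 (Or.inr rfl)
  have hF : ∀ v, F.Adj (p v) (q v) := fun v => ⟨hpq v, v, hp v, hq v⟩
  let e : V → Sym2 ι := fun v => s(p v, q v)
  have hme : ∀ v i, i ∈ e v ↔ v ∈ C i := fun v i => by
    rw [hmem]; exact Sym2.mem_iff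
  have heF : ∀ v, e v ∈ F.edgeSet := hF
  have einj : Function.Injective e := fun v w h => by
    refine hinter _ _ _ _ (hpq v) (hp v) (hq v) ?_ ?_
    · rw [← hme, ← h, hme]; exact hp v
    · rw [← hme, ← h, hme]; exact hq v
  have esurj : ∀ i j, F.Adj i j → ∃ v, v ∈ C i ∧ e v = s(i, j) := by
    rintro i j ⟨hij, v, hi, hj⟩
    exact ⟨v, hi, (Sym2.mem_and_mem_iff hij).1 ⟨(hme v i).2 hi, (hme v j).2 hj⟩⟩
  refine ⟨F, fun i => ?_, ⟨⟨Equiv.ofBijective (fun v => (⟨e v, heF v⟩ : F.edgeSet)) ⟨?_, ?_⟩, ?_⟩⟩⟩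
  -- The edges of `F` at `i` are exactly the images under the injection `e` of the vertices of `C
  -- i`.
  · rw [← SimpleGraph.card_incidenceFinset_eq_degree]
    refine (congrArg Finset.card ?_).trans (Finset.card_image_of_injective (C i) einj)
    ext s
    rw [SimpleGraph.mem_incidenceFinset, Finset.mem_image]
    constructor
    · rintro ⟨hs, his⟩
      obtain ⟨j, rfl⟩ := Sym2.mem_iff_exists.1 his
      exact esurj i j hs
    · rintro ⟨v, hv, rfl⟩
      exact ⟨heF v, (hme v i).2 hv⟩
  · intro v w h
    exact einj (congrArg Subtype.val h)
  · rintro ⟨s, hs⟩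
    induction s using Sym2.ind with
    | _ i j =>
      obtain ⟨v, -, hv⟩ := esurj i j hs
      exact ⟨v, Subtype.ext hv⟩
  · intro u v
    rw [SimpleGraph.lineGraph_adj_iff_exists]
    change ((⟨e u, heF u⟩ : F.edgeSet) ≠ ⟨e v, heF v⟩ ∧ ∃ i, i ∈ e u ∧ i ∈ e v) ↔ _
    simp only [ne_eq, Subtype.mk.injEq, hme, einj.eq_iff]
    by_cases huv : u = v
    · subst huv; simp
    · simp [huv, hadj u v huv]

/-! ### Consistent splittings of neighbourhoods -/

variable {V : Type*} {G : SimpleGraph V}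

/-- The neighbourhood of `v` contains no induced path on three vertices. -/
def DisjointCliquesNbhd (G : SimpleGraph V) (v : V) : Prop :=
  ∀ x y z, G.Adj v x → G.Adj v y → G.Adj v z → G.Adj x y → G.Adj y z → x ≠ z → G.Adj x z

/-- The neighbourhood of `v` is partitioned into two cliques `A` and `B` of two or three vertices,
each having a vertex without neighbours in the other one, and with restrictions on the edges
between `A` and `B`. -/
structure NbhdSplit (G : SimpleGraph V) (v : V) (A B : Finset V) : Prop where
  mem_or : ∀ u, G.Adj v u ↔ u ∈ A ∨ u ∈ B
  disj : ∀ u, u ∈ A → u ∉ B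
  cliqueA : ∀ a ∈ A, ∀ a' ∈ A, a ≠ a' → G.Adj a a'
  cliqueB : ∀ b ∈ B, ∀ b' ∈ B, b ≠ b' → G.Adj b b'
  card_or : A.card = 3 ∨ B.card = 3
  card_cross : ∀ a ∈ A, ∀ b ∈ B, G.Adj a b → A.card = 3 ∧ B.card = 3
  nonemptyA : A.Nonempty
  nonemptyB : B.Nonempty
  cross : ∃ x ∈ A, ∃ y ∈ B, (∀ b ∈ B, ¬ G.Adj x b) ∧ (∀ a ∈ A, ¬ G.Adj a y) ∧
    ((∀ a ∈ A, ∀ b ∈ B, ∀ a' ∈ A, ∀ b' ∈ B, G.Adj a b → G.Adj a' b' → a = a' ∧ b = b') ∨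
      (DisjointCliquesNbhd G x ∧ DisjointCliquesNbhd G y))

theorem NbhdSplit.swap {v : V} {A B : Finset V} (h : NbhdSplit G v A B) : NbhdSplit G v B A where
  mem_or u := (h.mem_or u).trans or_comm
  disj u hu hu' := h.disj u hu' hu
  cliqueA := h.cliqueB
  cliqueB := h.cliqueA
  card_or := h.card_or.symm
  card_cross a ha b hb hab := (h.card_cross b hb a ha hab.symm).symm
  nonemptyA := h.nonemptyB
  nonemptyB := h.nonemptyA
  cross := by
    obtain ⟨x, hx, y, hy, hxB, hyA, hc⟩ := h.cross
    refine ⟨y, hy, x, hx, fun a ha hay => hyA a ha hay.symm, fun b hb hbx => hxB b hb hbx.symm, ?_⟩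
    refine hc.imp (fun hc a ha b hb a' ha' b' hb' hab hab' => ?_) And.symm
    exact (hc b hb a ha b' hb' a' ha' hab.symm hab'.symm).symm

/-- If `u` and `w` lie in the same part of the neighbourhood of `v`, then `v` and `w` lie in the
same part of the neighbourhood of `u`. -/
theorem NbhdSplit.same_part {u v w : V} {A B A' B' : Finset V} (h : NbhdSplit G v A B)
    (h' : NbhdSplit G u A' B') (hu : u ∈ A) (hw : w ∈ A) (hv : v ∈ A') (hw' : w ∈ B') : False := by
  have hvu : G.Adj v u := (h.mem_or u).2 (Or.inl hu)
  have hvw : G.Adj v w := (h.mem_or w).2 (Or.inl hw)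
  have huw : G.Adj u w := (h'.mem_or w).2 (Or.inr hw')
  -- The edge `vw` crosses the split at `u`, so `A'` has size 3. Its vertex `a` without neighbours
  -- in `B'` misses `w`, hence lies in `B`, and `ua` crosses the split at `v`. The third vertex `a'`
  -- of `A'` will give a second crossing edge at `v`.
  obtain ⟨hA'3, -⟩ := h'.card_cross v hv w hw' hvw
  obtain ⟨a, ha, b, hb, haB', hbA', -⟩ := h'.cross
  have hub : G.Adj u b := (h'.mem_or b).2 (Or.inr hb)
  have hua : G.Adj u a := (h'.mem_or a).2 (Or.inl ha)
  have hvb : ¬ G.Adj v b := hbA' v hv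
  have hbw : b ≠ w := by rintro rfl; exact hvb hvw
  have hwb : G.Adj w b := h'.cliqueB w hw' b hb hbw.symm
  have haw : ¬ G.Adj a w := haB' w hw'
  have hav : a ≠ v := by rintro rfl; exact haw hvw
  have hva : G.Adj v a := h'.cliqueA v hv a ha hav.symm
  have haw' : a ≠ w := by rintro rfl; exact h'.disj a ha hw'
  have haB : a ∈ B := by
    rcases (h.mem_or a).1 hva with haA | haB
    · exact absurd (h.cliqueA a haA w hw haw') haw
    · exact haB
  have hvb' : v ≠ b := by rintro rfl; exact h'.disj v hv hb
  -- The path `v u b` is induced, so no vertex adjacent to all three has a path-free neighbourhood.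
  have hP3 : ∀ x, G.Adj x v → G.Adj x u → G.Adj x b → ¬ DisjointCliquesNbhd G x :=
    fun x h1 h2 h3 hx => hvb (hx v u b h1 h2 h3 hvu hub hvb')
  obtain ⟨hA3, -⟩ := h.card_cross u hu a haB hua
  obtain ⟨x, hx, y, hy, hxB, hyA, hc⟩ := h.cross
  have hxu : x ≠ u := by rintro rfl; exact hxB a haB hua
  have hvx : G.Adj v x := (h.mem_or x).2 (Or.inl hx)
  obtain ⟨a', ha', hne⟩ : ∃ a' ∈ A', a' ∉ ({v, a} : Finset V) :=
    Finset.exists_mem_notMem_of_card_lt_card (by rw [hA'3]; exact (Finset.card_le_two).trans_lt (by norm_num))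
  simp only [Finset.mem_insert, Finset.mem_singleton, not_or] at hne
  obtain ⟨ha'v, ha'a⟩ := hne
  have hva' : G.Adj v a' := h'.cliqueA v hv a' ha' (Ne.symm ha'v)
  have hua' : G.Adj u a' := (h'.mem_or a').2 (Or.inl ha')
  have haa' : G.Adj a' a := h'.cliqueA a' ha' a ha ha'a
  have ha'w : a' ≠ w := by rintro rfl; exact h'.disj a' ha' hw'
  -- The second crossing edge is `a'a` if `a' ∈ A` and `ua'` if `a' ∈ B`. This refutes uniqueness of
  -- the crossing edge; in the other alternative `x` sees the whole path `v u b`.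
  rcases (h.mem_or a').1 hva' with ha'A | ha'B
  · have hxa' : x ≠ a' := by rintro rfl; exact hxB a haB haa'
    have hxw : x = w := by
      by_contra hxw
      have hsub : ({x, w, a', u} : Finset V) ⊆ A := by
        intro t ht
        simp only [Finset.mem_insert, Finset.mem_singleton] at ht
        rcases ht with rfl | rfl | rfl | rfl <;> assumption
      have := Finset.card_le_card hsub
      rw [Finset.card_insert_of_notMem (by simp [hxw, hxa', hxu]),
        Finset.card_insert_of_notMem (by simp [ha'w.symm, huw.ne.symm]),
        Finset.card_pair hua'.ne.symm] at this
      omega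
    subst hxw
    rcases hc with hc | ⟨hc, -⟩
    · exact hua'.ne (hc u hu a haB a' ha'A a haB hua haa').1
    · exact hP3 x hvx.symm huw.symm hwb hc
  · rcases hc with hc | ⟨hc, -⟩
    · exact ha'a (hc u hu a haB u hu a' ha'B hua hua').2.symm
    · have hux : G.Adj u x := h.cliqueA u hu x hx hxu.symm
      refine hP3 x hvx.symm hux.symm ?_ hc
      rcases (h'.mem_or x).1 hux with hxA' | hxB'
      · exfalso
        refine hxB a haB (h'.cliqueA x hxA' a ha ?_)
        rintro rfl
        exact h.disj x hx haB
      · refine h'.cliqueB x hxB' b hb ?_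
        rintro rfl
        exact hvb hvx

/-- If `u` lies in the part `A` of the neighbourhood of `v`, then `v` lies in a part `A'` of the
neighbourhood of `u`, and both parts give the same clique. -/
theorem NbhdSplit.insert_eq {u v : V} {A B A' B' : Finset V} (h : NbhdSplit G v A B)
    (h' : NbhdSplit G u A' B') (hu : u ∈ A) (hv : v ∈ A') : insert v A = insert u A' := by
  have key : ∀ {u v : V} {A B A' B' : Finset V}, NbhdSplit G v A B → NbhdSplit G u A' B' →
      u ∈ A → v ∈ A' → insert v A ⊆ insert u A' := by
    intro u v A B A' B' h h' hu hv w hw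
    rw [Finset.mem_insert] at hw ⊢
    rcases hw with rfl | hw
    · exact Or.inr hv
    by_cases hwu : w = u
    · exact Or.inl hwu
    rcases (h'.mem_or w).1 (h.cliqueA u hu w hw (Ne.symm hwu)) with hw' | hw'
    · exact Or.inr hw'
    · exact (h.same_part h' hu hw hv hw').elim
  exact (key h h' hu hv).antisymm (key h' h hv hu)

theorem NbhdSplit.notMem {v : V} {A B : Finset V} (h : NbhdSplit G v A B) : v ∉ A :=
  fun hv => G.loopless.irrefl v ((h.mem_or v).2 (Or.inl hv))

/-- If every neighbourhood splits, then the graph is a line graph. -/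
theorem exists_lineGraph_of_nbhdSplit [Fintype V] [Nonempty V]
    (hcard : ∀ s : Finset V, G.IsClique s → s.card ≤ 4)
    (h : ∀ v, ∃ A B, NbhdSplit G v A B) :
    ∃ (n : ℕ) (F : SimpleGraph (Fin n)), F.maxDegree = 4 ∧ Nonempty (G ≃g F.lineGraph) := by
  choose A B hs using h
  let P : V → Finset V := fun v => insert v (A v)
  let Q : V → Finset V := fun v => insert v (B v)
  let K : Finset (Finset V) := Finset.univ.image P ∪ Finset.univ.image Q
  have hK : ∀ C, C ∈ K ↔ ∃ v, C = P v ∨ C = Q v := fun C => by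
    simp only [K, Finset.mem_union, Finset.mem_image, Finset.mem_univ, true_and, eq_comm (b := C),
      exists_or]
  have hin : ∀ v S T, NbhdSplit G v S T → ∀ u, u ∈ S → insert v S = P u ∨ insert v S = Q u := by
    intro v S T hst u hu
    rcases ((hs u).mem_or v).1 ((hst.mem_or u).2 (Or.inl hu)).symm with hv | hv
    · exact Or.inl (hst.insert_eq (hs u) hu hv)
    · exact Or.inr (hst.insert_eq (hs u).swap hu hv)
  have hmem : ∀ C ∈ K, ∀ v, v ∈ C ↔ C = P v ∨ C = Q v := by
    intro C hC v
    constructor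
    · intro hv
      obtain ⟨u, rfl | rfl⟩ := (hK C).1 hC
      · rcases Finset.mem_insert.1 hv with rfl | hv
        · exact Or.inl rfl
        · exact hin u _ _ (hs u) v hv
      · rcases Finset.mem_insert.1 hv with rfl | hv
        · exact Or.inr rfl
        · exact hin u _ _ (hs u).swap v hv
    · rintro (rfl | rfl) <;> exact Finset.mem_insert_self _ _
  have hPQi : ∀ u v, v ∈ P u → v ∈ Q u → u = v := by
    intro u v hP hQ
    rcases Finset.mem_insert.1 hP with hP | hP
    · exact hP.symm
    rcases Finset.mem_insert.1 hQ with hQ | hQ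
    · exact hQ.symm
    exact ((hs u).disj v hP hQ).elim
  have hPQ : ∀ v, P v ≠ Q v := by
    intro v hv
    obtain ⟨a, ha⟩ := (hs v).nonemptyA
    have := hPQi v a (Finset.mem_insert_of_mem ha) (hv ▸ Finset.mem_insert_of_mem ha)
    subst this
    exact (hs v).notMem ha
  have hclq : ∀ v S T, NbhdSplit G v S T → G.IsClique (insert v S : Finset V) := by
    intro v S T hst
    rw [Finset.coe_insert, SimpleGraph.isClique_insert]
    exact ⟨fun a ha b hb hab => hst.cliqueA a ha b hb hab, fun b hb _ => (hst.mem_or b).2 (Or.inl hb)⟩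
  have hKclq : ∀ C ∈ K, G.IsClique (C : Set V) := by
    intro C hC
    obtain ⟨u, rfl | rfl⟩ := (hK C).1 hC
    · exact hclq u _ _ (hs u)
    · exact hclq u _ _ (hs u).swap
  have hP : ∀ v, P v ∈ K := fun v => (hK _).2 ⟨v, Or.inl rfl⟩
  have hQ : ∀ v, Q v ∈ K := fun v => (hK _).2 ⟨v, Or.inr rfl⟩
  let e := K.equivFin
  obtain ⟨F, hF, hiso⟩ := exists_iso_lineGraph_of_cliques G (fun i => (e.symm i : Finset V))
    (fun v => e ⟨P v, hP v⟩) (fun v => e ⟨Q v, hQ v⟩)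
    (fun v hv => hPQ v (congrArg Subtype.val (e.injective hv)))
    (fun v i => by
      rw [hmem _ (e.symm i).2, ← Equiv.symm_apply_eq, ← Equiv.symm_apply_eq, Subtype.ext_iff,
        Subtype.ext_iff])
    (fun u v huv => by
      constructor
      · intro hadj
        rcases ((hs u).mem_or v).1 hadj with hv | hv
        · exact ⟨e ⟨P u, hP u⟩, by simp [P], by simp [P, hv]⟩
        · exact ⟨e ⟨Q u, hQ u⟩, by simp [Q], by simp [Q, hv]⟩
      · rintro ⟨i, hu, hv⟩
        exact hKclq _ (e.symm i).2 hu hv huv)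
    (fun i j u v hij hui huj hvi hvj => by
      have hne : (e.symm i : Finset V) ≠ e.symm j := fun h => hij (e.symm.injective (Subtype.ext h))
      rcases (hmem _ (e.symm i).2 u).1 hui with hi | hi <;>
        rcases (hmem _ (e.symm j).2 u).1 huj with hj | hj
      · exact (hne (hi.trans hj.symm)).elim
      · exact hPQi u v (hi ▸ hvi) (hj ▸ hvj)
      · exact hPQi u v (hj ▸ hvj) (hi ▸ hvi)
      · exact (hne (hi.trans hj.symm)).elim)
  refine ⟨K.card, F, le_antisymm ?_ ?_, hiso⟩
  · refine SimpleGraph.maxDegree_le_of_forall_degree_le _ _ fun i => ?_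
    rw [hF]
    exact hcard _ (hKclq _ (e.symm i).2)
  -- A part of size 3 together with its centre is a vertex of degree 4 in `F`.
  · obtain ⟨C, hC, hC4⟩ : ∃ C ∈ K, C.card = 4 := by
      obtain ⟨v⟩ := ‹Nonempty V›
      rcases (hs v).card_or with h3 | h3
      · exact ⟨P v, hP v, by rw [Finset.card_insert_of_notMem (hs v).notMem, h3]⟩
      · exact ⟨Q v, hQ v, by rw [Finset.card_insert_of_notMem (hs v).swap.notMem, h3]⟩
    refine le_trans ?_ (F.degree_le_maxDegree (e ⟨C, hC⟩))
    rw [hF]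
    simp [hC4]

end LineGraphs

/-! ### Counting in claw-free graphs without 5-cliques -/

section ClawFreeNeighbourhoods
open Classical

variable {V : Type*} {G : SimpleGraph V}

theorem ClawFree.adj_or (h : ClawFree G) {c x y z : V} (hx : G.Adj c x) (hy : G.Adj c y)
    (hz : G.Adj c z) (hxy : x ≠ y) (hxz : x ≠ z) (hyz : y ≠ z) :
    G.Adj x y ∨ G.Adj x z ∨ G.Adj y z := by
  by_contra hcon
  push Not at hcon
  obtain ⟨h1, h2, h3⟩ := hcon
  have h1' := fun h' : G.Adj y x => h1 h'.symm
  have h2' := fun h' : G.Adj z x => h2 h'.symm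
  have h3' := fun h' : G.Adj z y => h3 h'.symm
  refine h ⟨⟨⟨Sum.elim (fun _ => c) ![x, y, z], ?_⟩, ?_⟩⟩
  · rintro (i | i) (j | j) hij
    · exact congrArg _ (Subsingleton.elim i j)
    · fin_cases j <;> simp_all
    · fin_cases i <;> simp_all
    · fin_cases i <;> fin_cases j <;> simp_all
  · intro s t
    change G.Adj (Sum.elim (fun _ => c) ![x, y, z] s) (Sum.elim (fun _ => c) ![x, y, z] t) ↔ _
    rcases s with i | i <;> rcases t with j | j
    · simp
    · fin_cases j <;> simp_all
    · fin_cases i <;> simp_all [G.adj_comm]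
    · fin_cases i <;> fin_cases j <;> simp_all

theorem card_le_three_of_clique (hcard : ∀ s : Finset V, G.IsClique s → s.card ≤ 4)
    {x : V} {s : Finset V} (hs : ∀ a ∈ s, ∀ b ∈ s, a ≠ b → G.Adj a b) (hx : ∀ a ∈ s, G.Adj x a) :
    s.card ≤ 3 := by
  have hxs : x ∉ s := fun h => G.loopless.irrefl x (hx x h)
  have := hcard (insert x s) (by
    rw [Finset.coe_insert, SimpleGraph.isClique_insert]
    exact ⟨fun a ha b hb hab => hs a ha b hb hab, fun b hb _ => hx b hb⟩)
  rw [Finset.card_insert_of_notMem hxs] at this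
  omega

theorem card_le_two_of_clique (hcard : ∀ s : Finset V, G.IsClique s → s.card ≤ 4)
    {x y : V} (hxy : G.Adj x y) {s : Finset V} (hs : ∀ a ∈ s, ∀ b ∈ s, a ≠ b → G.Adj a b)
    (hx : ∀ a ∈ s, G.Adj x a) (hy : ∀ a ∈ s, G.Adj y a) : s.card ≤ 2 := by
  have hys : y ∉ s := fun h => G.loopless.irrefl y (hy y h)
  have := card_le_three_of_clique hcard (x := x) (s := insert y s) (by
      intro a ha b hb hab
      rcases Finset.mem_insert.1 ha with ha | ha <;> rcases Finset.mem_insert.1 hb with hb | hb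
      · exact absurd (ha.trans hb.symm) hab
      · exact ha ▸ hy b hb
      · exact hb ▸ (hy a ha).symm
      · exact hs a ha b hb hab) (by
      intro a ha
      rcases Finset.mem_insert.1 ha with rfl | ha
      · exact hxy
      · exact hx a ha)
  rw [Finset.card_insert_of_notMem hys] at this
  omega

variable [Fintype V]

/-- The vertices at distance exactly two from `v`. -/
noncomputable def secondNbhd (G : SimpleGraph V) (v : V) : Finset V :=
  Finset.univ.filter fun w => w ≠ v ∧ ¬ G.Adj v w ∧ ∃ z, G.Adj v z ∧ G.Adj z w

/-- The neighbours of `x` outside the closed neighbourhood of `v`. -/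
noncomputable def outerNbrs (G : SimpleGraph V) (v x : V) : Finset V :=
  Finset.univ.filter fun w => w ≠ v ∧ ¬ G.Adj v w ∧ G.Adj x w

/-- The common neighbours of `v` and `x`. -/
noncomputable def commonNbrs (G : SimpleGraph V) (v x : V) : Finset V :=
  Finset.univ.filter fun w => G.Adj v w ∧ G.Adj x w

/-- The neighbours of `v` that are neither equal nor adjacent to `x`. -/
noncomputable def nonNbrs (G : SimpleGraph V) (v x : V) : Finset V :=
  Finset.univ.filter fun w => G.Adj v w ∧ w ≠ x ∧ ¬ G.Adj x w

/-- The common neighbours of `v` and `x` form a clique. -/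
def SimplicialAt (G : SimpleGraph V) (v x : V) : Prop :=
  ∀ y z, G.Adj v y → G.Adj v z → G.Adj x y → G.Adj x z → y ≠ z → G.Adj y z

/-- The neighbours of `v` that are not simplicial in the neighbourhood of `v`. -/
noncomputable def nonSimplicialNbrs (G : SimpleGraph V) (v : V) : Finset V :=
  Finset.univ.filter fun x => G.Adj v x ∧ ¬ SimplicialAt G v x

theorem degree_graphSquare (v : V) :
    (graphSquare G).degree v = G.degree v + (secondNbhd G v).card := by
  rw [← SimpleGraph.card_neighborFinset_eq_degree, ← SimpleGraph.card_neighborFinset_eq_degree,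
    ← Finset.card_union_of_disjoint]
  · congr 1
    ext w
    simp only [SimpleGraph.mem_neighborFinset, secondNbhd, Finset.mem_union,
      Finset.mem_filter, Finset.mem_univ, true_and]
    constructor
    · rintro ⟨hne, h | h⟩
      · exact Or.inl h
      · by_cases hvw : G.Adj v w
        · exact Or.inl hvw
        · exact Or.inr ⟨hne.symm, hvw, h⟩
    · rintro (h | ⟨hne, -, h⟩)
      · exact ⟨h.ne, Or.inl h⟩
      · exact ⟨hne.symm, Or.inr h⟩
  · rw [Finset.disjoint_left]
    intro w hw hw'
    simp only [secondNbhd, Finset.mem_filter] at hw'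
    exact hw'.2.2.1 ((G.mem_neighborFinset _ _).1 hw)

theorem degree_eq_commonNbrs_add_nonNbrs {v x : V} (hx : G.Adj v x) :
    G.degree v = (commonNbrs G v x).card + 1 + (nonNbrs G v x).card := by
  have hxn : x ∉ commonNbrs G v x := by simp [commonNbrs]
  rw [← SimpleGraph.card_neighborFinset_eq_degree, ← Finset.card_insert_of_notMem hxn,
    ← Finset.card_union_of_disjoint]
  · congr 1
    ext w
    simp only [SimpleGraph.mem_neighborFinset, commonNbrs, nonNbrs, Finset.mem_union,
      Finset.mem_insert, Finset.mem_filter, Finset.mem_univ, true_and]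
    by_cases hw : w = x
    · simp [hw, hx]
    · simp only [hw, false_or, ne_eq, not_false_eq_true, true_and]
      tauto
  · rw [Finset.disjoint_left]
    intro w hw hw'
    simp only [commonNbrs, nonNbrs, Finset.mem_insert, Finset.mem_filter] at hw hw'
    tauto

theorem adj_of_mem_outerNbrs (hclaw : ClawFree G) {v x a b : V} (hx : G.Adj v x)
    (ha : a ∈ outerNbrs G v x) (hb : b ∈ outerNbrs G v x) (hab : a ≠ b) : G.Adj a b := by
  simp only [outerNbrs, Finset.mem_filter, Finset.mem_univ, true_and] at ha hb
  rcases hclaw.adj_or hx.symm ha.2.2 hb.2.2 ha.1.symm hb.1.symm hab with h | h | h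
  · exact absurd h ha.2.1
  · exact absurd h hb.2.1
  · exact h

theorem card_outerNbrs_le (hclaw : ClawFree G) (hcard : ∀ s : Finset V, G.IsClique s → s.card ≤ 4)
    {v x : V} (hx : G.Adj v x) : (outerNbrs G v x).card ≤ 3 :=
  card_le_three_of_clique hcard (fun _ ha _ hb hab => adj_of_mem_outerNbrs hclaw hx ha hb hab)
    (x := x) fun a ha => by
      simp only [outerNbrs, Finset.mem_filter, Finset.mem_univ, true_and] at ha
      exact ha.2.2

theorem adj_of_mem_nonNbrs (hclaw : ClawFree G) {v x a b : V} (hx : G.Adj v x)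
    (ha : a ∈ nonNbrs G v x) (hb : b ∈ nonNbrs G v x) (hab : a ≠ b) : G.Adj a b := by
  simp only [nonNbrs, Finset.mem_filter, Finset.mem_univ, true_and] at ha hb
  rcases hclaw.adj_or hx ha.1 hb.1 ha.2.1.symm hb.2.1.symm hab with h | h | h
  · exact absurd h ha.2.2
  · exact absurd h hb.2.2
  · exact h

theorem card_nonNbrs_le (hclaw : ClawFree G) (hcard : ∀ s : Finset V, G.IsClique s → s.card ≤ 4)
    {v x : V} (hx : G.Adj v x) : (nonNbrs G v x).card ≤ 3 :=
  card_le_three_of_clique hcard (fun _ ha _ hb hab => adj_of_mem_nonNbrs hclaw hx ha hb hab)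
    (x := v) fun a ha => by
      simp only [nonNbrs, Finset.mem_filter, Finset.mem_univ, true_and] at ha
      exact ha.1

theorem SimplicialAt.adj {v x a b : V} (h : SimplicialAt G v x) (ha : a ∈ commonNbrs G v x)
    (hb : b ∈ commonNbrs G v x) (hab : a ≠ b) : G.Adj a b := by
  simp only [commonNbrs, Finset.mem_filter, Finset.mem_univ, true_and] at ha hb
  exact h a b ha.1 hb.1 ha.2 hb.2 hab

theorem SimplicialAt.card_commonNbrs_le (hcard : ∀ s : Finset V, G.IsClique s → s.card ≤ 4)
    {v x : V} (hx : G.Adj v x) (h : SimplicialAt G v x) : (commonNbrs G v x).card ≤ 2 :=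
  card_le_two_of_clique hcard hx (fun _ ha _ hb hab => h.adj ha hb hab)
    (fun a ha => by
      simp only [commonNbrs, Finset.mem_filter, Finset.mem_univ, true_and] at ha; exact ha.1)
    (fun a ha => by
      simp only [commonNbrs, Finset.mem_filter, Finset.mem_univ, true_and] at ha; exact ha.2)

/-- This is R(3,3) = 6: the common neighbours contain no independent triple, by claw-freeness at
`v`, and no triangle, which with `v` and `x` would be a 5-clique. -/
theorem card_commonNbrs_le (hclaw : ClawFree G)
    (hcard : ∀ s : Finset V, G.IsClique s → s.card ≤ 4) {v x : V} (hx : G.Adj v x) :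
    (commonNbrs G v x).card ≤ 5 := by
  rcases (commonNbrs G v x).eq_empty_or_nonempty with h0 | ⟨p, hp⟩
  · simp [h0]
  have hmem : ∀ a, a ∈ commonNbrs G v x ↔ G.Adj v a ∧ G.Adj x a := by simp [commonNbrs]
  have hsub : commonNbrs G v x ⊆ insert p (((commonNbrs G v x).filter (G.Adj p)) ∪
      ((commonNbrs G v x).filter fun a => a ≠ p ∧ ¬ G.Adj p a)) := by
    intro a ha
    simp only [Finset.mem_insert, Finset.mem_union, Finset.mem_filter, ha, true_and]
    tauto
  have h1 : ((commonNbrs G v x).filter fun a => a ≠ p ∧ ¬ G.Adj p a).card ≤ 2 := by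
    refine card_le_two_of_clique hcard hx ?_ ?_ ?_
    · intro a ha b hb hab
      simp only [Finset.mem_filter, hmem] at ha hb hp
      rcases hclaw.adj_or hp.1 ha.1.1 hb.1.1 ha.2.1.symm hb.2.1.symm hab with h | h | h
      · exact absurd h ha.2.2
      · exact absurd h hb.2.2
      · exact h
    · intro a ha
      simp only [Finset.mem_filter, hmem] at ha
      exact ha.1.1
    · intro a ha
      simp only [Finset.mem_filter, hmem] at ha
      exact ha.1.2
  have h2 : ((commonNbrs G v x).filter (G.Adj p)).card ≤ 2 := by
    by_contra hlt
    obtain ⟨a, ha, b, hb, c, hc, hab, hac, hbc⟩ := Finset.two_lt_card.1 (not_le.1 hlt)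
    have hK : ∀ a b, a ∈ (commonNbrs G v x).filter (G.Adj p) →
        b ∈ (commonNbrs G v x).filter (G.Adj p) → ¬ G.Adj a b := by
      intro a b ha hb hab
      simp only [Finset.mem_filter, hmem] at ha hb hp
      have := card_le_two_of_clique hcard hx (s := {p, a, b}) (by
        intro s hs t ht hst
        simp only [Finset.mem_insert, Finset.mem_singleton] at hs ht
        rcases hs with rfl | rfl | rfl <;> rcases ht with rfl | rfl | rfl <;>
          first
            | exact absurd rfl hst
            | assumption
            | exact hab.symm
            | exact ha.2
            | exact hb.2
            | exact ha.2.symm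
            | exact hb.2.symm) (by
        intro s hs
        simp only [Finset.mem_insert, Finset.mem_singleton] at hs
        rcases hs with rfl | rfl | rfl
        exacts [hp.1, ha.1.1, hb.1.1]) (by
        intro s hs
        simp only [Finset.mem_insert, Finset.mem_singleton] at hs
        rcases hs with rfl | rfl | rfl
        exacts [hp.2, ha.1.2, hb.1.2])
      rw [Finset.card_insert_of_notMem (by simp [ha.2.ne, hb.2.ne]), Finset.card_pair hab.ne]
        at this
      omega
    have hadj : ∀ a, a ∈ (commonNbrs G v x).filter (G.Adj p) → G.Adj v a := by
      intro a ha
      simp only [Finset.mem_filter, hmem] at ha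
      exact ha.1.1
    rcases hclaw.adj_or (hadj a ha) (hadj b hb) (hadj c hc) hab hac hbc with h | h | h
    · exact hK a b ha hb h
    · exact hK a c ha hc h
    · exact hK b c hb hc h
  have h3 := Finset.card_le_card hsub
  have h4 := Finset.card_insert_le p (((commonNbrs G v x).filter (G.Adj p)) ∪
      ((commonNbrs G v x).filter fun a => a ≠ p ∧ ¬ G.Adj p a))
  have h5 := Finset.card_union_le ((commonNbrs G v x).filter (G.Adj p))
      ((commonNbrs G v x).filter fun a => a ≠ p ∧ ¬ G.Adj p a)
  omega

/-- Every outer neighbour `w` of `x` is adjacent to all but at most two of the common neighbours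
of `v` and `x`. -/
theorem card_commonNbrs_le_of_outer (hclaw : ClawFree G)
    (hcard : ∀ s : Finset V, G.IsClique s → s.card ≤ 4) {v x w : V} (hx : G.Adj v x)
    (hw : w ∈ outerNbrs G v x) :
    (commonNbrs G v x).card ≤ ((G.neighborFinset v).filter fun y => G.Adj y w).card + 1 := by
  simp only [outerNbrs, Finset.mem_filter, Finset.mem_univ, true_and] at hw
  have hmem : ∀ a, a ∈ commonNbrs G v x ↔ G.Adj v a ∧ G.Adj x a := by simp [commonNbrs]
  -- Two nonadjacent vertices of this set would form a claw at `x` with `w`; so the set is a clique,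
  -- joined completely to the edge `vx`.
  have h1 : ((commonNbrs G v x).filter fun y => ¬ G.Adj y w).card ≤ 2 := by
    refine card_le_two_of_clique hcard hx ?_ ?_ ?_
    · intro a ha b hb hab
      simp only [Finset.mem_filter, hmem] at ha hb
      have hwa : w ≠ a := by rintro rfl; exact hw.2.1 ha.1.1
      have hwb : w ≠ b := by rintro rfl; exact hw.2.1 hb.1.1
      rcases hclaw.adj_or hw.2.2 ha.1.2 hb.1.2 hwa hwb hab with h | h | h
      · exact absurd h.symm ha.2
      · exact absurd h.symm hb.2
      · exact h
    · intro a ha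
      simp only [Finset.mem_filter, hmem] at ha
      exact ha.1.1
    · intro a ha
      simp only [Finset.mem_filter, hmem] at ha
      exact ha.1.2
  have h2 : insert x ((commonNbrs G v x).filter fun y => G.Adj y w) ⊆
      (G.neighborFinset v).filter fun y => G.Adj y w := by
    intro a ha
    simp only [Finset.mem_insert, Finset.mem_filter, hmem] at ha
    simp only [Finset.mem_filter, SimpleGraph.mem_neighborFinset]
    rcases ha with rfl | ha
    · exact ⟨hx, hw.2.2⟩
    · exact ⟨ha.1.1, ha.2⟩
  have h3 := Finset.card_le_card h2
  rw [Finset.card_insert_of_notMem (by simp [hmem])] at h3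
  have h4 := Finset.card_filter_add_card_filter_not (s := commonNbrs G v x) (fun y => G.Adj y w)
  omega

/-- Double counting of the edges between the first and second neighbourhood of `v`, with weights. -/
theorem mul_card_secondNbhd_le (hclaw : ClawFree G)
    (hcard : ∀ s : Finset V, G.IsClique s → s.card ≤ 4) {v : V} (m : ℕ) (f : V → ℕ)
    (hf : ∀ w x, G.Adj v x → w ∈ outerNbrs G v x →
      m ≤ ∑ y ∈ (G.neighborFinset v).filter (fun y => G.Adj y w), f y) :
    m * (secondNbhd G v).card ≤ ∑ x ∈ G.neighborFinset v, 3 * f x := by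
  calc m * (secondNbhd G v).card = ∑ w ∈ secondNbhd G v, m := by simp [mul_comm]
    _ ≤ ∑ w ∈ secondNbhd G v, ∑ y ∈ (G.neighborFinset v).filter (fun y => G.Adj y w), f y := by
        refine Finset.sum_le_sum fun w hw => ?_
        simp only [secondNbhd, Finset.mem_filter, Finset.mem_univ, true_and] at hw
        obtain ⟨h1, h2, x, h3, h4⟩ := hw
        exact hf w x h3 (by simp [outerNbrs, h1, h2, h4])
    _ = ∑ y ∈ G.neighborFinset v, ∑ w ∈ (secondNbhd G v).filter (fun w => G.Adj y w), f y := by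
        refine Finset.sum_comm' fun w y => ?_
        simp only [Finset.mem_filter]
        tauto
    _ ≤ ∑ x ∈ G.neighborFinset v, 3 * f x := by
        refine Finset.sum_le_sum fun x hx => ?_
        rw [Finset.sum_const, smul_eq_mul]
        refine Nat.mul_le_mul_right _ (le_trans (Finset.card_le_card ?_)
          (card_outerNbrs_le hclaw hcard ((G.mem_neighborFinset _ _).1 hx)))
        intro w hw
        simp only [secondNbhd, outerNbrs, Finset.mem_filter, Finset.mem_univ, true_and] at hw ⊢
        exact ⟨hw.1.1, hw.1.2.1, hw.2⟩

/-- Large degree makes `N(v)` dense, so a vertex at distance two has many neighbours in it and few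
such vertices exist. -/
theorem degree_graphSquare_le_of_seven_le_degree (hclaw : ClawFree G)
    (hcard : ∀ s : Finset V, G.IsClique s → s.card ≤ 4) {v : V} (hv : 7 ≤ G.degree v) :
    (graphSquare G).degree v ≤ 17 := by
  -- At most 3 vertices of `N(v)` miss `x`, so `v` and `x` have at least `deg(v) - 4` common
  -- neighbours, and `w` sees at least `deg(v) - 5` vertices of `N(v)`.
  have h := mul_card_secondNbhd_le hclaw hcard (v := v) (G.degree v - 5) (fun _ => 1) (by
    intro w x hx hw
    have h1 := card_commonNbrs_le_of_outer hclaw hcard hx hw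
    have h2 := degree_eq_commonNbrs_add_nonNbrs hx
    have h3 := card_nonNbrs_le hclaw hcard hx
    rw [Finset.sum_const, smul_eq_mul, mul_one]
    omega)
  obtain ⟨x, hx⟩ : (G.neighborFinset v).Nonempty := by
    rw [← Finset.card_pos, SimpleGraph.card_neighborFinset_eq_degree]; omega
  rw [SimpleGraph.mem_neighborFinset] at hx
  have h2 := degree_eq_commonNbrs_add_nonNbrs hx
  have h3 := card_nonNbrs_le hclaw hcard hx
  have h4 := card_commonNbrs_le hclaw hcard hx
  rw [Finset.sum_const, smul_eq_mul, SimpleGraph.card_neighborFinset_eq_degree] at h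
  rw [degree_graphSquare]
  have h9 : G.degree v ≤ 9 := by omega
  clear h2
  generalize G.degree v = n at *
  interval_cases n <;> omega

/-- Two nonadjacent common neighbours of `v` and `x` would form a claw at `x` with `w`, unless `w`
sees one of them. -/
theorem exists_ne_adj_of_not_simplicialAt (hclaw : ClawFree G) {v x w : V}
    (hw : w ∈ outerNbrs G v x) (hs : ¬ SimplicialAt G v x) :
    ∃ y, y ≠ x ∧ G.Adj v y ∧ G.Adj y w := by
  simp only [outerNbrs, Finset.mem_filter, Finset.mem_univ, true_and] at hw
  simp only [SimplicialAt, not_forall] at hs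
  obtain ⟨y, z, hvy, hvz, hxy, hxz, hne, hyz⟩ := hs
  have hwy : w ≠ y := by rintro rfl; exact hw.2.1 hvy
  have hwz : w ≠ z := by rintro rfl; exact hw.2.1 hvz
  rcases hclaw.adj_or hw.2.2 hxy hxz hwy hwz hne with h | h | h
  · exact ⟨y, hxy.ne', hvy, h.symm⟩
  · exact ⟨z, hxz.ne', hvz, h.symm⟩
  · exact absurd h hyz

/-- Weighting simplicial neighbours 2 and the others 1, every vertex at distance two receives weight
at least 2, and each neighbour gives its weight at most three times. -/
theorem two_mul_degree_graphSquare_le (hclaw : ClawFree G)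
    (hcard : ∀ s : Finset V, G.IsClique s → s.card ≤ 4) (v : V) :
    2 * (graphSquare G).degree v + 3 * (nonSimplicialNbrs G v).card ≤ 8 * G.degree v := by
  have h := mul_card_secondNbhd_le hclaw hcard (v := v) 2
    (fun x => if SimplicialAt G v x then 2 else 1) (by
    intro w x hx hw
    have hxw : G.Adj x w := by
      simp only [outerNbrs, Finset.mem_filter, Finset.mem_univ, true_and] at hw
      exact hw.2.2
    by_cases hs : SimplicialAt G v x
    · calc 2 = ∑ y ∈ {x}, (if SimplicialAt G v y then 2 else 1) := by simp [hs]
        _ ≤ _ := Finset.sum_le_sum_of_subset (by simp [hx, hxw])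
    · obtain ⟨y, hyx, hvy, hyw⟩ := exists_ne_adj_of_not_simplicialAt hclaw hw hs
      calc 2 = ∑ y ∈ {y, x}, 1 := by simp [hyx]
        _ ≤ ∑ y ∈ (G.neighborFinset v).filter (fun y => G.Adj y w), 1 :=
            Finset.sum_le_sum_of_subset (by
              intro t ht
              simp only [Finset.mem_insert, Finset.mem_singleton] at ht
              rcases ht with rfl | rfl <;> simp [*])
        _ ≤ _ := Finset.sum_le_sum fun y _ => by split_ifs <;> norm_num)
  have h1 : ∑ x ∈ G.neighborFinset v, 3 * (if SimplicialAt G v x then 2 else 1) +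
      3 * (nonSimplicialNbrs G v).card = 6 * G.degree v := by
    have : (nonSimplicialNbrs G v).card =
        ∑ x ∈ G.neighborFinset v, if SimplicialAt G v x then 0 else 1 := by
      have hset : nonSimplicialNbrs G v =
          (G.neighborFinset v).filter fun x => ¬ SimplicialAt G v x := by
        ext x; simp [nonSimplicialNbrs]
      rw [hset, Finset.card_filter]
      exact Finset.sum_congr rfl fun x _ => by split_ifs <;> simp_all
    rw [this, Finset.mul_sum, ← Finset.sum_add_distrib,
      ← SimpleGraph.card_neighborFinset_eq_degree, mul_comm, ← smul_eq_mul, ← Finset.sum_const]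
    exact Finset.sum_congr rfl fun x _ => by split_ifs <;> norm_num
  rw [degree_graphSquare]
  omega

end ClawFreeNeighbourhoods

/-! ### Neighbourhoods forced by large square degree -/

section LargeSquareDegree
open Classical

variable {V : Type*} [Fintype V] {G : SimpleGraph V}

/-- The neighbourhood of a vertex `v` whose degree in the square is at least `20`. -/
theorem exists_cliques_of_twenty_le (hclaw : ClawFree G)
    (hcard : ∀ s : Finset V, G.IsClique s → s.card ≤ 4) {v : V}
    (hv : 20 ≤ (graphSquare G).degree v) :
    ∃ A B : Finset V, (∀ u, G.Adj v u ↔ u ∈ A ∨ u ∈ B) ∧ (∀ u, u ∈ A → u ∉ B) ∧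
      (∀ a ∈ A, ∀ a' ∈ A, a ≠ a' → G.Adj a a') ∧ (∀ b ∈ B, ∀ b' ∈ B, b ≠ b' → G.Adj b b') ∧
      A.card ≤ 3 ∧ B.card ≤ 3 ∧ A.card + B.card = G.degree v ∧ 5 ≤ G.degree v ∧
      (nonSimplicialNbrs G v).card ≤ 2 ∧ (∃ x ∈ A, ∀ b ∈ B, ¬ G.Adj x b) ∧
      ∀ a ∈ A, ∀ b ∈ B, G.Adj a b → A.card = 3 ∧ B.card = 3 ∧
        a ∈ nonSimplicialNbrs G v ∧ b ∈ nonSimplicialNbrs G v := by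
  have hmain := two_mul_degree_graphSquare_le hclaw hcard v
  have h7 : G.degree v < 7 := by
    by_contra h
    have := degree_graphSquare_le_of_seven_le_degree hclaw hcard (not_lt.1 h)
    omega
  -- At most two of the at least five neighbours are non-simplicial. A simplicial `x` gives the
  -- parts: `x` with its neighbours in `N(v)`, and its non-neighbours there.
  obtain ⟨x, hx, hxs⟩ : ∃ x ∈ G.neighborFinset v, x ∉ nonSimplicialNbrs G v := by
    refine Finset.exists_mem_notMem_of_card_lt_card ?_
    rw [SimpleGraph.card_neighborFinset_eq_degree]
    omega
  rw [SimpleGraph.mem_neighborFinset] at hx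
  have hxs : SimplicialAt G v x := by simpa [nonSimplicialNbrs, hx] using hxs
  have hdeg := degree_eq_commonNbrs_add_nonNbrs hx
  have hcC : ∀ a, a ∈ commonNbrs G v x ↔ G.Adj v a ∧ G.Adj x a := by simp [commonNbrs]
  have hcN : ∀ a, a ∈ nonNbrs G v x ↔ G.Adj v a ∧ a ≠ x ∧ ¬ G.Adj x a := by simp [nonNbrs]
  have hA : (insert x (commonNbrs G v x)).card = (commonNbrs G v x).card + 1 :=
    Finset.card_insert_of_notMem (by simp [hcC])
  have hA2 := hxs.card_commonNbrs_le hcard hx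
  have hB3 := card_nonNbrs_le hclaw hcard hx
  refine ⟨insert x (commonNbrs G v x), nonNbrs G v x, ?_, ?_, ?_,
    fun b hb b' hb' => adj_of_mem_nonNbrs hclaw hx hb hb', by omega, hB3, by omega, by omega,
    by omega, ⟨x, Finset.mem_insert_self _ _, fun b hb => ((hcN b).1 hb).2.2⟩, ?_⟩
  · intro u
    rw [Finset.mem_insert, hcC, hcN]
    by_cases hu : u = x
    · simp [hu, hx]
    · simp only [hu, false_or, ne_eq, not_false_eq_true, true_and]
      tauto
  · intro u
    rw [Finset.mem_insert, hcC, hcN]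
    tauto
  · intro a ha a' ha' hne
    rw [Finset.mem_insert] at ha ha'
    rcases ha with rfl | ha <;> rcases ha' with rfl | ha'
    · exact absurd rfl hne
    · exact ((hcC _).1 ha').2
    · exact ((hcC _).1 ha).2.symm
    · exact hxs.adj ha ha' hne
  · intro a ha b hb hab
    have hbN := (hcN b).1 hb
    have haC : G.Adj v a ∧ G.Adj x a := by
      rcases Finset.mem_insert.1 ha with rfl | ha
      · exact absurd hab hbN.2.2
      · exact (hcC a).1 ha
    have han : a ∈ nonSimplicialNbrs G v := by
      simp only [nonSimplicialNbrs, Finset.mem_filter, Finset.mem_univ, true_and]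
      exact ⟨haC.1, fun h => hbN.2.2 (h x b hx hbN.1 haC.2.symm hab hbN.2.1.symm)⟩
    -- One non-simplicial neighbour already excludes degree 5, since `40 + 3 > 8 * 5`; with degree 6
    -- both parts have size 3.
    have hpos : 0 < (nonSimplicialNbrs G v).card := Finset.card_pos.2 ⟨a, han⟩
    have hB : (nonNbrs G v x).card = 3 := by omega
    refine ⟨by omega, hB, han, ?_⟩
    simp only [nonSimplicialNbrs, Finset.mem_filter, Finset.mem_univ, true_and]
    refine ⟨hbN.1, fun h => ?_⟩
    -- If `b` were simplicial, `a` would be adjacent to all of `B`, and `v`, `a`, `B` would form a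
    -- 5-clique.
    have := card_le_two_of_clique hcard haC.1 (s := nonNbrs G v x)
      (fun b hb b' hb' => adj_of_mem_nonNbrs hclaw hx hb hb') (fun b hb => ((hcN b).1 hb).1)
      (fun b' hb' => by
        by_cases hbb : b = b'
        · exact hbb ▸ hab
        · exact h a b' haC.1 ((hcN b').1 hb').1 hab.symm (adj_of_mem_nonNbrs hclaw hx hb hb' hbb)
            (by rintro rfl; exact ((hcN a).1 hb').2.2 haC.2))
    omega

theorem exists_nbhdSplit_of_twenty_le (hclaw : ClawFree G)
    (hcard : ∀ s : Finset V, G.IsClique s → s.card ≤ 4) {v : V}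
    (hv : 20 ≤ (graphSquare G).degree v) : ∃ A B, NbhdSplit G v A B := by
  obtain ⟨A, B, hmem, hdisj, hA, hB, hA3, hB3, hsum, h5, hns, ⟨x, hx, hxB⟩, hcross⟩ :=
    exists_cliques_of_twenty_le hclaw hcard hv
  -- Both ends of a crossing edge are non-simplicial, so two crossing edges would produce three such
  -- vertices.
  have hone : ∀ a ∈ A, ∀ b ∈ B, ∀ a' ∈ A, ∀ b' ∈ B, G.Adj a b → G.Adj a' b' →
      a = a' ∧ b = b' := by
    intro a ha b hb a' ha' b' hb' hab hab'
    obtain ⟨-, -, h1, h2⟩ := hcross a ha b hb hab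
    obtain ⟨-, -, h1', h2'⟩ := hcross a' ha' b' hb' hab'
    have hne : ∀ s ∈ A, ∀ t ∈ B, s ≠ t := by
      rintro s hs t ht rfl; exact hdisj s hs ht
    constructor
    · by_contra h
      exact (Finset.two_lt_card.2 ⟨a, h1, a', h1', b, h2, h, hne a ha b hb, hne a' ha' b hb⟩).not_ge
        hns
    · by_contra h
      exact (Finset.two_lt_card.2 ⟨b, h2, b', h2', a, h1, h, (hne a ha b hb).symm,
        (hne a ha b' hb').symm⟩).not_ge hns
  obtain ⟨y, hy, hyA⟩ : ∃ y ∈ B, ∀ a ∈ A, ¬ G.Adj a y := by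
    by_cases h : ∃ a ∈ A, ∃ b ∈ B, G.Adj a b
    · obtain ⟨a, ha, b, hb, hab⟩ := h
      obtain ⟨y, hy, hyb⟩ := Finset.exists_mem_ne (s := B) (by omega) b
      exact ⟨y, hy, fun a' ha' h' => hyb (hone a ha b hb a' ha' y hy hab h').2.symm⟩
    · push Not at h
      obtain ⟨y, hy⟩ : B.Nonempty := Finset.card_pos.1 (by omega)
      exact ⟨y, hy, fun a ha => h a ha y hy⟩
  exact ⟨A, B, hmem, hdisj, hA, hB, by omega,
    fun a ha b hb hab => ⟨(hcross a ha b hb hab).1, (hcross a ha b hb hab).2.1⟩,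
    ⟨x, hx⟩, ⟨y, hy⟩, x, hx, y, hy, hxB, hyA, Or.inl hone⟩

/-- If `v` has at most six neighbours, all simplicial but for an adjacent pair, then its degree in
the square is at most `20`. -/
theorem degree_graphSquare_le_of_pair (hclaw : ClawFree G)
    (hcard : ∀ s : Finset V, G.IsClique s → s.card ≤ 4) {v a b : V} (hdeg : G.degree v ≤ 6)
    (hab : G.Adj a b) (ha : a ∈ nonSimplicialNbrs G v) (hb : b ∈ nonSimplicialNbrs G v)
    (hns : (nonSimplicialNbrs G v).card ≤ 2) : (graphSquare G).degree v ≤ 20 := by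
  have hM : nonSimplicialNbrs G v = {a, b} :=
    (Finset.eq_of_subset_of_card_le (by
      intro t ht
      rcases Finset.mem_insert.1 ht with rfl | ht
      · exact ha
      · exact Finset.mem_singleton.1 ht ▸ hb) (by rw [Finset.card_pair hab.ne]; exact hns)).symm
  have hva : G.Adj v a := by
    simp only [nonSimplicialNbrs, Finset.mem_filter] at ha; exact ha.2.1
  have hvb : G.Adj v b := by
    simp only [nonSimplicialNbrs, Finset.mem_filter] at hb; exact hb.2.1
  have hnsim : ∀ t, t ∈ nonSimplicialNbrs G v → ¬ SimplicialAt G v t := fun t ht => by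
    simp only [nonSimplicialNbrs, Finset.mem_filter] at ht; exact ht.2.2
  let R := G.neighborFinset v \ {a, b}
  -- A vertex at distance two that is missed by `R` sees both `a` and `b`. The bound is therefore `6
  -- + 4 * 3 + 2 = 20`.
  have hsub : secondNbhd G v ⊆ R.biUnion (outerNbrs G v) ∪ (outerNbrs G v a ∩ outerNbrs G v b) := by
    intro w hw
    simp only [secondNbhd, Finset.mem_filter, Finset.mem_univ, true_and] at hw
    obtain ⟨hwv, hvw, z, hvz, hzw⟩ := hw
    have hout : ∀ z, w ∈ outerNbrs G v z ↔ G.Adj z w := by simp [outerNbrs, hwv, hvw]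
    by_cases h : ∃ z ∈ R, G.Adj z w
    · obtain ⟨z, hz, hzw⟩ := h
      exact Finset.mem_union_left _ (Finset.mem_biUnion.2 ⟨z, hz, (hout z).2 hzw⟩)
    push Not at h
    have hR : ∀ y, G.Adj v y → G.Adj y w → y = a ∨ y = b := by
      intro y hvy hyw
      by_contra hy
      exact h y (by simp only [R, Finset.mem_sdiff, SimpleGraph.mem_neighborFinset,
        Finset.mem_insert, Finset.mem_singleton]; exact ⟨hvy, hy⟩) hyw
    refine Finset.mem_union_right _ (Finset.mem_inter.2 ?_)
    rw [hout, hout]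
    rcases hR z hvz hzw with rfl | rfl
    · obtain ⟨y, hyz, hvy, hyw⟩ := exists_ne_adj_of_not_simplicialAt hclaw ((hout _).2 hzw)
        (hnsim _ ha)
      rcases hR y hvy hyw with rfl | rfl
      · exact absurd rfl hyz
      · exact ⟨hzw, hyw⟩
    · obtain ⟨y, hyz, hvy, hyw⟩ := exists_ne_adj_of_not_simplicialAt hclaw ((hout _).2 hzw)
        (hnsim _ hb)
      rcases hR y hvy hyw with rfl | rfl
      · exact ⟨hyw, hzw⟩
      · exact absurd rfl hyz
  have hRcard : R.card + 2 = G.degree v := by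
    rw [← Finset.card_pair hab.ne, Finset.card_sdiff_add_card_eq_card,
      SimpleGraph.card_neighborFinset_eq_degree]
    intro t ht
    rw [SimpleGraph.mem_neighborFinset]
    rcases Finset.mem_insert.1 ht with rfl | ht
    · exact hva
    · exact Finset.mem_singleton.1 ht ▸ hvb
  have h1 : (R.biUnion (outerNbrs G v)).card ≤ R.card * 3 :=
    Finset.card_biUnion_le_card_mul _ _ _ fun x hx => card_outerNbrs_le hclaw hcard
      ((G.mem_neighborFinset _ _).1 (Finset.mem_sdiff.1 hx).1)
  have h2 : (outerNbrs G v a ∩ outerNbrs G v b).card ≤ 2 := by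
    refine card_le_two_of_clique hcard hab
      (fun s hs t ht => adj_of_mem_outerNbrs hclaw hva (Finset.mem_inter.1 hs).1
        (Finset.mem_inter.1 ht).1) (fun s hs => ?_) (fun s hs => ?_)
    · have := (Finset.mem_inter.1 hs).1
      simp only [outerNbrs, Finset.mem_filter] at this
      exact this.2.2.2
    · have := (Finset.mem_inter.1 hs).2
      simp only [outerNbrs, Finset.mem_filter] at this
      exact this.2.2.2
  have h3 := (Finset.card_le_card hsub).trans (Finset.card_union_le _ _)
  rw [degree_graphSquare]
  omega

/-- The neighbourhood of a vertex whose degree in the square is at least `21` is a disjoint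
union of cliques, and the vertex has exactly six neighbours. -/
theorem disjointCliquesNbhd_of_twentyone_le (hclaw : ClawFree G)
    (hcard : ∀ s : Finset V, G.IsClique s → s.card ≤ 4) {v : V}
    (hv : 21 ≤ (graphSquare G).degree v) : DisjointCliquesNbhd G v ∧ G.degree v = 6 := by
  obtain ⟨A, B, hmem, hdisj, hA, hB, hA3, hB3, hsum, h5, hns, -, hcross⟩ :=
    exists_cliques_of_twenty_le hclaw hcard (le_trans (by norm_num) hv)
  have hmain := two_mul_degree_graphSquare_le hclaw hcard v
  have hno : ∀ a ∈ A, ∀ b ∈ B, ¬ G.Adj a b := by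
    intro a ha b hb hab
    obtain ⟨-, -, h1, h2⟩ := hcross a ha b hb hab
    have := degree_graphSquare_le_of_pair hclaw hcard (by omega) hab h1 h2 hns
    omega
  refine ⟨?_, by omega⟩
  intro x y z hx hy hz hxy hyz hxz
  rcases (hmem x).1 hx with hx | hx <;> rcases (hmem y).1 hy with hy | hy <;>
    rcases (hmem z).1 hz with hz | hz
  · exact hA x hx z hz hxz
  · exact absurd hyz (hno y hy z hz)
  · exact hA x hx z hz hxz
  · exact absurd hxy (hno x hx y hy)
  · exact absurd hxy.symm (hno y hy x hx)
  · exact hB x hx z hz hxz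
  · exact absurd hyz.symm (hno z hz y hy)
  · exact hB x hx z hz hxz

theorem commonNbrs_comm (v x : V) : commonNbrs G v x = commonNbrs G x v := by
  ext; simp [commonNbrs, and_comm]

/-- A vertex `v` with two neighbours of large degree in the square that have no common neighbour
other than `v`. -/
theorem exists_nbhdSplit_of_pair (hclaw : ClawFree G)
    (hcard : ∀ s : Finset V, G.IsClique s → s.card ≤ 4) {v x y : V} (hvx : G.Adj v x)
    (hvy : G.Adj v y) (hx : 21 ≤ (graphSquare G).degree x) (hy : 21 ≤ (graphSquare G).degree y)
    (hne : x ≠ y) (hxy : ¬ G.Adj x y) (hz : ∀ z, z ≠ v → G.Adj x z → ¬ G.Adj z y) :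
    ∃ A B, NbhdSplit G v A B := by
  have hmem : ∀ x a, a ∈ commonNbrs G v x ↔ G.Adj v a ∧ G.Adj x a := by simp [commonNbrs]
  have key : ∀ x, G.Adj v x → 21 ≤ (graphSquare G).degree x →
      (insert x (commonNbrs G v x)).card = 3 ∧
      (∀ a ∈ insert x (commonNbrs G v x), ∀ a' ∈ insert x (commonNbrs G v x), a ≠ a' →
        G.Adj a a') ∧ DisjointCliquesNbhd G x := by
    intro x hvx hx
    obtain ⟨hd, hdeg⟩ := disjointCliquesNbhd_of_twentyone_le hclaw hcard hx
    have hclq : ∀ a ∈ commonNbrs G v x, ∀ b ∈ commonNbrs G v x, a ≠ b → G.Adj a b := by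
      intro a ha b hb hab
      rw [hmem] at ha hb
      exact hd a v b ha.2 hvx.symm hb.2 ha.1.symm hb.1 hab
    have h1 : (commonNbrs G v x).card ≤ 2 :=
      card_le_two_of_clique hcard hvx hclq (fun a ha => ((hmem x a).1 ha).1)
        (fun a ha => ((hmem x a).1 ha).2)
    have h2 := degree_eq_commonNbrs_add_nonNbrs hvx.symm
    have h3 := card_nonNbrs_le hclaw hcard hvx.symm
    -- The six neighbours of `x` are `v`, at most 2 common neighbours with `v`, and at most 3
    -- others; so equality holds throughout.
    rw [commonNbrs_comm] at h2
    refine ⟨?_, ?_, hd⟩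
    · rw [Finset.card_insert_of_notMem (by simp [hmem])]
      omega
    · intro a ha a' ha' hne
      rw [Finset.mem_insert] at ha ha'
      rcases ha with rfl | ha <;> rcases ha' with rfl | ha'
      · exact absurd rfl hne
      · exact ((hmem _ _).1 ha').2
      · exact ((hmem _ _).1 ha).2.symm
      · exact hclq a ha a' ha' hne
  obtain ⟨hA3, hA, hxd⟩ := key x hvx hx
  obtain ⟨hB3, hB, hyd⟩ := key y hvy hy
  have hxs := Finset.mem_insert_self x (commonNbrs G v x)
  have hys := Finset.mem_insert_self y (commonNbrs G v y)
  have hxB : ∀ b ∈ insert y (commonNbrs G v y), ¬ G.Adj x b := by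
    intro b hb hxb
    rcases Finset.mem_insert.1 hb with rfl | hb
    · exact hxy hxb
    · rw [hmem] at hb
      exact hz b hb.1.ne' hxb hb.2.symm
  have hyA : ∀ a ∈ insert x (commonNbrs G v x), ¬ G.Adj a y := by
    intro a ha hay
    rcases Finset.mem_insert.1 ha with rfl | ha
    · exact hxy hay
    · rw [hmem] at ha
      exact hz a ha.1.ne' ha.2 hay
  refine ⟨insert x (commonNbrs G v x), insert y (commonNbrs G v y), ?_, ?_, hA, hB, Or.inl hA3,
    fun _ _ _ _ _ => ⟨hA3, hB3⟩, ⟨x, hxs⟩, ⟨y, hys⟩, x, hxs, y, hys, hxB, hyA, Or.inr ⟨hxd, hyd⟩⟩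
  · intro u
    simp only [Finset.mem_insert, hmem]
    constructor
    · intro hvu
      by_cases hux : u = x
      · exact Or.inl (Or.inl hux)
      by_cases huy : u = y
      · exact Or.inr (Or.inl huy)
      -- A neighbour of `v` missing both `x` and `y` would complete a claw at `v`.
      rcases hclaw.adj_or hvx hvy hvu hne (Ne.symm hux) (Ne.symm huy) with h | h | h
      · exact absurd h hxy
      · exact Or.inl (Or.inr ⟨hvu, h⟩)
      · exact Or.inr (Or.inr ⟨hvu, h⟩)
    · rintro ((rfl | h) | (rfl | h))
      exacts [hvx, h.1, hvy, h.1]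
  · intro u hu hu'
    rcases Finset.mem_insert.1 hu with rfl | hu
    · rcases Finset.mem_insert.1 hu' with rfl | hu'
      · exact hne rfl
      · exact hxy ((hmem _ _).1 hu').2.symm
    · exact hxB u hu' ((hmem _ _).1 hu).2

end LargeSquareDegree

/-! ### The dichotomy -/

open Classical in
theorem theorem5p3 {V : Type*} [Fintype V] (G : SimpleGraph V)
    (hconn : G.Connected) (hclaw : ClawFree G) (hω : G.cliqueNum = 4) :
    (∃ (n : ℕ) (F : SimpleGraph (Fin n)), F.maxDegree = 4 ∧ Nonempty (G ≃g F.lineGraph)) ∨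
    (∃ v : V, (graphSquare G).degree v ≤ 19 ∧
      (graphSquare (deleteVertex G v)).IsClique
        {x : {u : V // u ≠ v} | G.Adj v x ∧ 21 ≤ (graphSquare G).degree (x : V)}) := by
  have hcard : ∀ s : Finset V, G.IsClique s → s.card ≤ 4 := fun s hs => hω ▸ hs.card_le_cliqueNum
  have := hconn.nonempty
  by_contra hcon
  rw [not_or] at hcon
  refine hcon.1 (exists_lineGraph_of_nbhdSplit hcard fun v => ?_)
  by_cases hv : 20 ≤ (graphSquare G).degree v
  · exact exists_nbhdSplit_of_twenty_le hclaw hcard hv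
  by_contra hsplit
  refine hcon.2 ⟨v, by omega, ?_⟩
  rintro ⟨x, hxv⟩ ⟨hvx, hx⟩ ⟨y, hyv⟩ ⟨hvy, hy⟩ hne
  by_contra hadj
  have hne' : x ≠ y := fun h => hne (Subtype.ext h)
  exact hsplit (exists_nbhdSplit_of_pair hclaw hcard hvx hvy hx hy hne'
    (fun h => hadj ⟨hne, Or.inl h⟩) fun z hzv hxz hzy => hadj ⟨hne, Or.inr ⟨⟨z, hzv⟩, hxz, hzy⟩⟩)
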